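/- Let $\mathbb D$ be the open unit disk and $\mathbb T$ the unit circle in $\mathbb C$. Let $p\in\mathbb C[z_1,z_2]$ be a polynomial of degree $m$ in $z_1$ and degree $n$ in $z_2$ with no zeros in $\mathbb D^2$, let $$\tilde p(z_1,z_2)=z_1^m z_2^n\,\overline{p\left(1/\bar z_1,1/\bar z_2\right)}$$ be its reflection (again a polynomial), and assume that $p$ and $\tilde p$ have no nonconstant common factor. Let $\phi=\tilde p/p$ be the corresponding rational inner function on $\mathbb D^2$. A singularity of $\phi$ on $\mathbb T^2$ is a point $(\tau_1,\tau_2)\in\mathbb T^2$ with $p(\tau_1,\tau_2)=\tilde p(\tau_1,\tau_2)=0$. For $\zeta_2\in\mathbb T$ set $\epsilon(\phi,\zeta_2)=0$ if $\phi$ has a singularity on $\mathbb T^2$ with $z_2$-coordinate $\zeta_2$, and $$\epsilon(\phi,\zeta_2)=\inf\{\,1-|z_1| : z_1\in\mathbb C,\ \tilde p(z_1,\zeta_2)=0\,\}$$ otherwise (with the convention $\inf\emptyset=0$, which matters only if $p$ does not depend on $z_1$). Suppose that $\phi$ has a singularity on $\mathbb T^2$ with $z_2$-coordinate $\tau_2$.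 Then there is a unique rational number $K>0$ such that $$\epsilon(\phi,\zeta_2)\approx|\tau_2-\zeta_2|^K$$ for all $\zeta_2\in\mathbb T$ in a neighborhood of $\tau_2$; that is, there are constants $c,C>0$ and a neighborhood $U$ of $\tau_2$ such that $c\,|\tau_2-\zeta_2|^K\le\epsilon(\phi,\zeta_2)\le C\,|\tau_2-\zeta_2|^K$ for all $\zeta_2\in\mathbb T\cap U$. -/

import Mathlib

open MvPolynomial

/-- The reflection `p̃` of a two-variable polynomial `p` of bidegree `(m, n)`: the coefficient of
`z₁ ^ i * z₂ ^ j` in `p` is conjugated and moved to `z₁ ^ (m - i) * z₂ ^ (n - j)`. It is the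
polynomial with `p̃(z₁, z₂) = z₁ ^ m * z₂ ^ n * conj (p (1 / conj z₁, 1 / conj z₂))`,
see `eval_reflection`. -/
noncomputable def reflection (p : MvPolynomial (Fin 2) ℂ) : MvPolynomial (Fin 2) ℂ :=
  ∑ d ∈ p.support,
    C ((starRingEnd ℂ) (p.coeff d)) * X 0 ^ (p.degreeOf 0 - d 0) * X 1 ^ (p.degreeOf 1 - d 1)

theorem eval_reflection (p : MvPolynomial (Fin 2) ℂ) (z₁ z₂ : ℂ) (h₁ : z₁ ≠ 0) (h₂ : z₂ ≠ 0) :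
    eval ![z₁, z₂] (reflection p) = z₁ ^ p.degreeOf 0 * z₂ ^ p.degreeOf 1 *
      (starRingEnd ℂ) (eval ![1 / (starRingEnd ℂ) z₁, 1 / (starRingEnd ℂ) z₂] p) := by
  rw [reflection, eval_eq' (R := ℂ) ![1 / (starRingEnd ℂ) z₁, 1 / (starRingEnd ℂ) z₂] p]
  simp only [map_sum, map_mul, map_pow, eval_C, eval_X, Finset.mul_sum, Fin.prod_univ_two,
    Matrix.cons_val_zero, Matrix.cons_val_one, map_div₀, map_one, Complex.conj_conj]
  refine Finset.sum_congr rfl fun d hd => ?_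
  have e₁ := pow_sub₀ z₁ h₁ (monomial_le_degreeOf (0 : Fin 2) hd)
  have e₂ := pow_sub₀ z₂ h₂ (monomial_le_degreeOf (1 : Fin 2) hd)
  rw [e₁, e₂]
  simp only [one_div, inv_pow]
  ring

/-- `p` is an admissible denominator of a rational inner function `φ = p̃ / p` on the bidisk:
`p` has no zeros in the open bidisk and no nonconstant factor in common with `p̃`. -/
structure IsRIFDenominator (p : MvPolynomial (Fin 2) ℂ) : Prop where
  eval_ne_zero : ∀ z₁ z₂ : ℂ, ‖z₁‖ < 1 → ‖z₂‖ < 1 → eval ![z₁, z₂] p ≠ 0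
  isRelPrime : IsRelPrime p (reflection p)

/-- `φ = p̃ / p` has a singularity at the point `(τ₁, τ₂)` of the torus `𝕋²`: numerator and
denominator, which have no common factor, both vanish there. -/
def IsTorusSingularity (p : MvPolynomial (Fin 2) ℂ) (τ₁ τ₂ : ℂ) : Prop :=
  ‖τ₁‖ = 1 ∧ ‖τ₂‖ = 1 ∧ eval ![τ₁, τ₂] p = 0 ∧ eval ![τ₁, τ₂] (reflection p) = 0

open Classical in
/-- The quantity `ε(φ, ζ₂)` for `φ = p̃ / p` and `ζ₂ ∈ 𝕋`: it is `0` if `φ` has a singularity on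
`𝕋²` with second coordinate `ζ₂`, and otherwise the minimum of `1 - |z₁|` over the zeros `z₁` of
`p̃(·, ζ₂)`. -/
noncomputable def zeroDistance (p : MvPolynomial (Fin 2) ℂ) (ζ₂ : ℂ) : ℝ :=
  if ∃ τ₁ : ℂ, IsTorusSingularity p τ₁ ζ₂ then 0
  else sInf {t : ℝ | ∃ z₁ : ℂ, eval ![z₁, ζ₂] (reflection p) = 0 ∧ t = 1 - ‖z₁‖}

/-- `ε(φ, ζ₂) ≈ |τ₂ - ζ₂| ^ K` for all `ζ₂ ∈ 𝕋` in some neighborhood of `τ₂`. -/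
def HasContactExponent (p : MvPolynomial (Fin 2) ℂ) (τ₂ : ℂ) (K : ℝ) : Prop :=
  ∃ c C : ℝ, 0 < c ∧ 0 < C ∧ ∃ U ∈ nhds τ₂, ∀ ζ₂ ∈ U, ‖ζ₂‖ = 1 →
    c * ‖τ₂ - ζ₂‖ ^ K ≤ zeroDistance p ζ₂ ∧ zeroDistance p ζ₂ ≤ C * ‖τ₂ - ζ₂‖ ^ K

/-!
Fix `ζ` on the circle. By a Hurwitz type argument (`norm_eval_bounds_of_norm_le_one`) and coprimality,
`p(·, ζ)` has no zeros in `𝔻`, so `p̃(·, ζ)` has degree exactly `m = deg_{z₁} p` and all its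
zeros `a₁, …, aₘ` lie in the closed disk; `p(z, ζ)` is a constant times `∏ (1 - conj aₖ z)`. Thus
`ε(ζ) = min (1 - |aₖ|)`, and it vanishes only over singularities.

Instead of expanding the individual zeros in Puiseux series, the proof replaces `ε` by a symmetric
function of them. The sum

  `S(ζ) = ∑ⱼ ∑ₖ 1 / (1 - conj aₖ aⱼ)`

(`szegoSum`) satisfies `1 / (2 ε) ≤ |S| ≤ m² / ε`: each term has modulus at most `1 / ε` and
nonnegative real part, and the diagonal term at the zero nearest to the circle is at least
`1 / (2 ε)`. On the other hand, the logarithmic derivative of `p(·, ζ)` gives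
`S = ∑ⱼ (m p - z ∂p/∂z₁) / p` evaluated at `(aⱼ, ζ)`. By Gauss's lemma and the resultant there
are polynomials with `u p + v p̃ = r(z₂)` and `r ≠ 0`, so that `1 / p = u / r` at the zeros of `p̃`
(`sum_evalEval_eq_mul_szegoSum`). Hence `r S = N`, where `N(ζ)` is the sum of a polynomial over the
zeros of `p̃(·, ζ)`; by Newton's identities and Vieta's formulas, `N` is analytic at `τ₂`
(`analyticAt_sum_evalEval_roots`).

So `ε ≈ |r| / |N|` on the circle near `τ₂`, and both `r` and `N` are comparable to powers of
`|ζ - τ₂|`. The exponent `K` is the difference of the two orders of vanishing, an integer; it is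
positive since the zeros of `p̃(·, ζ)` come close to `τ₁` as `ζ → τ₂`.
-/

/-! ### Bivariate polynomials over `ℂ` and their slices -/

/-- The isomorphism `ℂ[z₁, z₂] ≃ ℂ[z₂][z₁]`: the outer variable of the target is `z₁`. -/
noncomputable def toBivariate : MvPolynomial (Fin 2) ℂ ≃ₐ[ℂ] Polynomial (Polynomial ℂ) :=
  (Polynomial.Bivariate.equivMvPolynomial ℂ).symm.trans Polynomial.Bivariate.swap

theorem toBivariate_X_zero : toBivariate (X 0) = Polynomial.X := by
  simpa [toBivariate] using Polynomial.Bivariate.swap_X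

theorem toBivariate_X_one : toBivariate (X 1) = Polynomial.C Polynomial.X := by
  simpa [toBivariate] using Polynomial.Bivariate.swap_Y

theorem toBivariate_C (a : ℂ) : toBivariate (C a) = Polynomial.C (Polynomial.C a) := by
  simpa [toBivariate] using Polynomial.Bivariate.swap_C_C a

theorem evalEval_toBivariate (p : MvPolynomial (Fin 2) ℂ) (z w : ℂ) :
    (toBivariate p).evalEval w z = eval ![z, w] p := by
  induction p using MvPolynomial.induction_on with
  | C a => simp [toBivariate_C]
  | add p q hp hq => simp [hp, hq]
  | mul_X p i hp =>
    fin_cases i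
    · simp [hp, toBivariate_X_zero]
    · simp [hp, toBivariate_X_one, Polynomial.evalEval_C]

/-- The polynomial `p(·, w)` in the single variable `z₁`. -/
noncomputable def slice (p : MvPolynomial (Fin 2) ℂ) (w : ℂ) : Polynomial ℂ :=
  (toBivariate p).map (Polynomial.evalRingHom w)

theorem eval_slice (p : MvPolynomial (Fin 2) ℂ) (z w : ℂ) :
    (slice p w).eval z = eval ![z, w] p := by
  rw [slice, Polynomial.map_evalRingHom_eval, evalEval_toBivariate]

theorem natDegree_toBivariate_monomial_le (a : ℂ) (i j : ℕ) :
    (toBivariate (C a * X 0 ^ i * X 1 ^ j)).natDegree ≤ i := by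
  rw [map_mul, map_mul, map_pow, map_pow, toBivariate_C, toBivariate_X_zero, toBivariate_X_one,
    ← Polynomial.C_pow]
  refine (Polynomial.natDegree_mul_C_le _ _).trans ?_
  exact Polynomial.natDegree_C_mul_X_pow_le _ _

theorem natDegree_toBivariate_le (p : MvPolynomial (Fin 2) ℂ) :
    (toBivariate p).natDegree ≤ p.degreeOf 0 := by
  conv_lhs => rw [p.as_sum, map_sum]
  refine Polynomial.natDegree_sum_le_of_forall_le _ _ fun d hd => ?_
  rw [monomial_eq, Finsupp.prod_fintype _ _ (fun _ => pow_zero _), Fin.prod_univ_two, ← mul_assoc]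
  exact (natDegree_toBivariate_monomial_le _ _ _).trans (monomial_le_degreeOf 0 hd)

theorem natDegree_toBivariate_reflection_le (p : MvPolynomial (Fin 2) ℂ) :
    (toBivariate (reflection p)).natDegree ≤ p.degreeOf 0 := by
  rw [reflection, map_sum]
  exact Polynomial.natDegree_sum_le_of_forall_le _ _ fun d _ =>
    (natDegree_toBivariate_monomial_le _ _ _).trans (Nat.sub_le _ _)

/-- A polynomial vanishing identically on a line `z₂ = w` is divisible by `z₂ - w`. -/
theorem X_sub_C_dvd_of_slice_eq_zero {p : MvPolynomial (Fin 2) ℂ} {w : ℂ}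
    (h : slice p w = 0) : X 1 - C w ∣ p := by
  have hd : Polynomial.C (Polynomial.X - Polynomial.C w) ∣ toBivariate p := by
    rw [Polynomial.C_dvd_iff_dvd_coeff]
    intro i
    rw [Polynomial.dvd_iff_isRoot]
    have := congrArg (fun f => Polynomial.coeff f i) h
    simpa [slice] using this
  have e : Polynomial.C (Polynomial.X - Polynomial.C w) = toBivariate (X 1 - C w) := by
    rw [map_sub toBivariate, toBivariate_X_one, toBivariate_C, Polynomial.C_sub]
  rw [e] at hd
  exact (map_dvd_iff toBivariate).mp hd

theorem not_isUnit_X_sub_C (w : ℂ) : ¬ IsUnit (X 1 - C w : MvPolynomial (Fin 2) ℂ) := by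
  intro h
  have := h.map (eval ![0, w])
  simp at this

/-! ### Coprimality in `R[X]` and Bézout over the base -/

open Polynomial in
/-- Gauss's lemma for coprimality. -/
theorem isCoprime_map_fractionRing {R K : Type*} [CommRing R] [IsDomain R] [IsGCDMonoid R]
    [Field K] [Algebra R K] [IsFractionRing R K] {f g : R[X]} (h : IsRelPrime f g) :
    IsCoprime (f.map (algebraMap R K)) (g.map (algebraMap R K)) := by
  classical
  let _ : NormalizedGCDMonoid R := Nonempty.some inferInstance
  have inj : Function.Injective (algebraMap R K) := IsFractionRing.injective R K
  -- clearing denominators in a common factor over `K` yields a primitive common factor over `R`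
  have key : ∀ (π : K[X]), π ≠ 0 → ∀ f : R[X], π ∣ f.map (algebraMap R K) →
      (IsLocalization.integerNormalization (nonZeroDivisors R) π).primPart ∣ f := by
    intro π hπ f hf
    set d := IsLocalization.integerNormalization (nonZeroDivisors R) π with hd
    by_cases hf0 : f = 0
    · rw [hf0]
      exact dvd_zero _
    refine dvd_trans ?_ f.primPart_dvd
    refine d.isPrimitive_primPart.dvd_of_fraction_map_dvd_fraction_map (K := K) ?_
    obtain ⟨b, hb, e⟩ := IsLocalization.integerNormalization_spec (nonZeroDivisors R) π
    have hb0 : algebraMap R K b ≠ 0 := by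
      simpa using (map_ne_zero_iff _ inj).mpr (nonZeroDivisors.ne_zero hb)
    have h1 : d.primPart.map (algebraMap R K) ∣ π := by
      have : d.primPart.map (algebraMap R K) ∣ Polynomial.C (algebraMap R K b) * π := by
        have e' : Polynomial.C (algebraMap R K b) * π = d.map (algebraMap R K) := by
          rw [hd, e, Algebra.smul_def, Polynomial.algebraMap_apply]
        rw [e']
        exact Polynomial.map_dvd _ d.primPart_dvd
      exact ((Polynomial.isUnit_C.mpr hb0.isUnit).dvd_mul_left).mp this
    refine h1.trans ?_
    have hc0 : algebraMap R K f.content ≠ 0 :=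
      (map_ne_zero_iff _ inj).mpr (by rwa [Ne, content_eq_zero_iff])
    rw [f.eq_C_content_mul_primPart, Polynomial.map_mul, Polynomial.map_C] at hf
    exact ((Polynomial.isUnit_C.mpr hc0.isUnit).dvd_mul_left).mp hf
  refine isCoprime_of_irreducible_dvd ?_ fun π hπ hf hg => ?_
  · rintro ⟨h1, h2⟩
    rw [Polynomial.map_eq_zero_iff inj] at h1 h2
    subst h1 h2
    exact not_isUnit_zero (h (dvd_refl _) (dvd_refl _))
  · exact hπ.not_isUnit (isUnit_or_eq_zero_of_isUnit_integerNormalization_primPart hπ.ne_zero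
      (h (key π hπ.ne_zero f hf) (key π hπ.ne_zero g hg)))

open Polynomial in
theorem exists_mul_add_mul_eq_C_of_isRelPrime {R : Type*} [CommRing R] [IsDomain R] [IsGCDMonoid R]
    {f g : R[X]} (h : IsRelPrime f g) : ∃ u v : R[X], ∃ r : R, r ≠ 0 ∧ u * f + v * g = Polynomial.C r := by
  by_cases hd : f.natDegree = 0 ∧ g.natDegree = 0
  · obtain ⟨a, rfl⟩ := natDegree_eq_zero.mp hd.1
    obtain ⟨b, rfl⟩ := natDegree_eq_zero.mp hd.2
    by_cases ha : a = 0
    · subst ha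
      have hb : b ≠ 0 := by
        rintro rfl
        exact not_isUnit_zero (h (d := 0) (by simp) (by simp))
      exact ⟨0, 1, b, hb, by simp⟩
    · exact ⟨1, 0, a, ha, by simp⟩
  · have inj : Function.Injective (algebraMap R (FractionRing R)) := IsFractionRing.injective _ _
    have hres := resultant_ne_zero _ _ (isCoprime_map_fractionRing (K := FractionRing R) h)
    rw [natDegree_map_eq_of_injective inj, natDegree_map_eq_of_injective inj, resultant_map_map,
      map_ne_zero_iff _ inj] at hres
    obtain ⟨u, v, -, -, e⟩ := exists_mul_add_mul_eq_C_resultant f g le_rfl le_rfl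
      (by rwa [← not_and_or])
    exact ⟨u, v, _, hres, by rw [← e]; ring⟩

/-! ### Zeros of slices over the circle -/

/-- A polynomial without zeros in `𝔻` obeys Harnack type bounds: each factor `1 - z / w`
with `|w| ≥ 1` has modulus between `1 - |z|` and `1 + |z|`. -/
theorem norm_eval_bounds_of_forall_ne_zero {f : Polynomial ℂ} {m : ℕ} (hm : f.natDegree ≤ m)
    (hf : ∀ z : ℂ, ‖z‖ < 1 → f.eval z ≠ 0) {z : ℂ} (hz : ‖z‖ < 1) :
    ‖f.eval 0‖ * (1 - ‖z‖) ^ m ≤ ‖f.eval z‖ ∧ ‖f.eval z‖ ≤ ‖f.eval 0‖ * (1 + ‖z‖) ^ m := by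
  have hsplit := IsAlgClosed.splits f
  have hcard : f.roots.card ≤ m := (Polynomial.card_roots' f).trans hm
  have hroots : ∀ w ∈ f.roots, 1 ≤ ‖w‖ := by
    intro w hw
    by_contra! h
    exact hf w h (Polynomial.isRoot_of_mem_roots hw)
  have heval : ∀ x, f.eval x = f.leadingCoeff * (f.roots.map fun w => x - w).prod := fun x => by
    conv_lhs => rw [hsplit.eq_prod_roots]
    simp [Polynomial.eval_mul, Polynomial.eval_multiset_prod]
  -- the same bounds for `∏ (z - w)` over a multiset of points outside `𝔻`
  have hprod : ∀ s : Multiset ℂ, (∀ w ∈ s, 1 ≤ ‖w‖) →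
      ‖(s.map fun w => 0 - w).prod‖ * (1 - ‖z‖) ^ s.card ≤ ‖(s.map fun w => z - w).prod‖ ∧
      ‖(s.map fun w => z - w).prod‖ ≤ ‖(s.map fun w => 0 - w).prod‖ * (1 + ‖z‖) ^ s.card := by
    intro s
    induction s using Multiset.induction_on with
    | empty => simp
    | cons a s ih =>
      intro h
      obtain ⟨h1, h2⟩ := ih fun w hw => h w (Multiset.mem_cons_of_mem hw)
      have ha := h a (Multiset.mem_cons_self a s)
      simp only [Multiset.map_cons, Multiset.prod_cons, norm_mul, Multiset.card_cons, pow_succ,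
        zero_sub, norm_neg] at h1 h2 ⊢
      have b1 : ‖a‖ * (1 - ‖z‖) ≤ ‖z - a‖ := by
        have := norm_sub_norm_le a z
        rw [norm_sub_rev] at this
        nlinarith [norm_nonneg z]
      have b2 : ‖z - a‖ ≤ ‖a‖ * (1 + ‖z‖) := by
        have := norm_sub_le z a
        nlinarith [norm_nonneg z]
      have hz0 : 0 ≤ 1 - ‖z‖ := by linarith
      constructor
      · calc _ = (‖a‖ * (1 - ‖z‖)) * (‖(s.map fun w => -w).prod‖ * (1 - ‖z‖) ^ s.card) := by ring
          _ ≤ _ := by gcongr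
      · calc _ ≤ (‖a‖ * (1 + ‖z‖)) * (‖(s.map fun w => -w).prod‖ * (1 + ‖z‖) ^ s.card) := by gcongr
          _ = _ := by ring
  obtain ⟨h1, h2⟩ := hprod f.roots hroots
  simp only [heval, norm_mul]
  have hz0 : 0 ≤ 1 - ‖z‖ := by linarith
  constructor
  · calc _ ≤ ‖f.leadingCoeff‖ * ‖(f.roots.map fun w => 0 - w).prod‖ * (1 - ‖z‖) ^ f.roots.card := by
          gcongr ?_ * ?_
          exact pow_le_pow_of_le_one hz0 (by linarith [norm_nonneg z]) hcard
      _ ≤ _ := by rw [mul_assoc]; gcongr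
  · calc _ ≤ ‖f.leadingCoeff‖ * (‖(f.roots.map fun w => 0 - w).prod‖ * (1 + ‖z‖) ^ f.roots.card) := by
          gcongr
      _ ≤ _ := by
          rw [mul_assoc]
          gcongr
          linarith [norm_nonneg z]

theorem natDegree_slice_le (p : MvPolynomial (Fin 2) ℂ) (w : ℂ) :
    (slice p w).natDegree ≤ p.degreeOf 0 :=
  Polynomial.natDegree_map_le.trans (natDegree_toBivariate_le p)

theorem natDegree_slice_reflection_le (p : MvPolynomial (Fin 2) ℂ) (w : ℂ) :
    (slice (reflection p) w).natDegree ≤ p.degreeOf 0 :=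
  Polynomial.natDegree_map_le.trans (natDegree_toBivariate_reflection_le p)

theorem continuous_eval_pair (p : MvPolynomial (Fin 2) ℂ) (z : ℂ) :
    Continuous fun w => eval ![z, w] p := by
  refine (MvPolynomial.continuous_eval p).comp (continuous_pi fun i => ?_)
  fin_cases i <;> simp <;> fun_prop

/-- The bounds of `norm_eval_bounds_of_forall_ne_zero` pass to the limit from `𝔻` to its closure. -/
theorem norm_eval_bounds_of_norm_le_one {p : MvPolynomial (Fin 2) ℂ}
    (hp : ∀ z₁ z₂ : ℂ, ‖z₁‖ < 1 → ‖z₂‖ < 1 → eval ![z₁, z₂] p ≠ 0) {z w : ℂ} (hz : ‖z‖ < 1)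
    (hw : ‖w‖ ≤ 1) :
    ‖eval ![0, w] p‖ * (1 - ‖z‖) ^ p.degreeOf 0 ≤ ‖eval ![z, w] p‖ ∧
      ‖eval ![z, w] p‖ ≤ ‖eval ![0, w] p‖ * (1 + ‖z‖) ^ p.degreeOf 0 := by
  have hball : ∀ w ∈ Metric.ball (0 : ℂ) 1,
      ‖eval ![0, w] p‖ * (1 - ‖z‖) ^ p.degreeOf 0 ≤ ‖eval ![z, w] p‖ ∧
      ‖eval ![z, w] p‖ ≤ ‖eval ![0, w] p‖ * (1 + ‖z‖) ^ p.degreeOf 0 := by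
    intro w hw
    rw [mem_ball_zero_iff] at hw
    have := norm_eval_bounds_of_forall_ne_zero (natDegree_slice_le p w)
      (fun x hx => by rw [eval_slice]; exact hp x w hx hw) hz
    simpa only [eval_slice] using this
  have hw' : w ∈ closure (Metric.ball (0 : ℂ) 1) := by
    rw [closure_ball _ one_ne_zero]; simpa using hw
  have c0 := (continuous_eval_pair p 0).norm
  have cz := (continuous_eval_pair p z).norm
  have hcl : IsClosed {w | ‖eval ![0, w] p‖ * (1 - ‖z‖) ^ p.degreeOf 0 ≤ ‖eval ![z, w] p‖ ∧
      ‖eval ![z, w] p‖ ≤ ‖eval ![0, w] p‖ * (1 + ‖z‖) ^ p.degreeOf 0} :=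
    (isClosed_le (c0.mul continuous_const) cz).inter (isClosed_le cz (c0.mul continuous_const))
  exact hcl.closure_subset_iff.mpr hball hw'

theorem eval_reflection_of_norm_eq_one (p : MvPolynomial (Fin 2) ℂ) {z w : ℂ} (hz : z ≠ 0)
    (hw : ‖w‖ = 1) : eval ![z, w] (reflection p) =
      z ^ p.degreeOf 0 * w ^ p.degreeOf 1 *
        (starRingEnd ℂ) (eval ![((starRingEnd ℂ) z)⁻¹, w] p) := by
  have hw0 : w ≠ 0 := by rintro rfl; simp at hw
  have e : 1 / (starRingEnd ℂ) w = w := by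
    have : (starRingEnd ℂ) w * w = 1 := by rw [Complex.conj_mul', hw]; simp
    rw [eq_comm, eq_div_iff (by simpa using hw0), mul_comm, this]
  rw [eval_reflection p z w hz hw0, e, one_div]

/-- If `p(0, w) = 0`, the bounds force `p(·, w) = 0`, and then `z₂ - w` divides both `p` and `p̃`. -/
theorem IsRIFDenominator.eval_zero_ne_zero {p : MvPolynomial (Fin 2) ℂ} (hp : IsRIFDenominator p)
    {w : ℂ} (hw : ‖w‖ = 1) : eval ![0, w] p ≠ 0 := by
  intro h0
  have hball : ∀ z : ℂ, ‖z‖ < 1 → eval ![z, w] p = 0 := fun z hz => by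
    have := (norm_eval_bounds_of_norm_le_one hp.eval_ne_zero hz hw.le).2
    rw [h0] at this
    simpa using this
  have hinf : (Metric.ball (0 : ℂ) 1).Infinite :=
    infinite_of_mem_nhds 0 (Metric.ball_mem_nhds 0 one_pos)
  have hs : slice p w = 0 := Polynomial.eq_zero_of_infinite_isRoot _ <| hinf.mono fun z hz => by
    show (slice p w).eval z = 0
    rw [eval_slice, hball z (by simpa using hz)]
  have hs' : slice (reflection p) w = 0 := by
    refine Polynomial.eq_zero_of_infinite_isRoot _ <|
      (Set.finite_singleton (0 : ℂ)).infinite_compl.mono fun z hz => ?_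
    show (slice (reflection p) w).eval z = 0
    rw [eval_slice, eval_reflection_of_norm_eq_one p hz hw, ← eval_slice p, hs]
    simp
  exact not_isUnit_X_sub_C w (hp.isRelPrime (X_sub_C_dvd_of_slice_eq_zero hs)
    (X_sub_C_dvd_of_slice_eq_zero hs'))

theorem IsRIFDenominator.eval_ne_zero_of_norm_eq_one {p : MvPolynomial (Fin 2) ℂ}
    (hp : IsRIFDenominator p) {z w : ℂ} (hz : ‖z‖ < 1) (hw : ‖w‖ = 1) : eval ![z, w] p ≠ 0 := by
  have h := (norm_eval_bounds_of_norm_le_one hp.eval_ne_zero hz hw.le).1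
  have h0 : 0 < ‖eval ![0, w] p‖ := norm_pos_iff.mpr (hp.eval_zero_ne_zero hw)
  have h1 : 0 < 1 - ‖z‖ := by linarith
  exact norm_pos_iff.mp (lt_of_lt_of_le (by positivity) h)

theorem eval_reflect {f : Polynomial ℂ} {m : ℕ} (hf : f.natDegree ≤ m) {z : ℂ} (hz : z ≠ 0) :
    (f.reflect m).eval z = z ^ m * f.eval z⁻¹ := by
  let _ : Invertible z⁻¹ := invertibleOfNonzero (inv_ne_zero hz)
  have := Polynomial.eval₂_reflect_mul_pow (RingHom.id ℂ) z⁻¹ m f hf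
  simp only [Polynomial.eval₂_id, invOf_eq_inv, inv_inv] at this
  rw [← this, inv_pow]
  field_simp

theorem slice_reflection (p : MvPolynomial (Fin 2) ℂ) {w : ℂ} (hw : ‖w‖ = 1) :
    slice (reflection p) w = Polynomial.C (w ^ p.degreeOf 1) *
      ((slice p w).map (starRingEnd ℂ)).reflect (p.degreeOf 0) := by
  refine Polynomial.eq_of_infinite_eval_eq _ _ <|
    (Set.finite_singleton (0 : ℂ)).infinite_compl.mono fun z hz => ?_
  have hz : z ≠ 0 := hz
  have e : (starRingEnd ℂ) (eval ![((starRingEnd ℂ) z)⁻¹, w] p) =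
      ((slice p w).map (starRingEnd ℂ)).eval z⁻¹ := by
    have := Polynomial.eval_map_apply (starRingEnd ℂ) (p := slice p w) (x := ((starRingEnd ℂ) z)⁻¹)
    rw [← eval_slice, ← this, map_inv₀, Complex.conj_conj]
  show (slice (reflection p) w).eval z = _
  rw [eval_slice, eval_reflection_of_norm_eq_one p hz hw, Polynomial.eval_mul, Polynomial.eval_C,
    eval_reflect (Polynomial.natDegree_map_le.trans (natDegree_slice_le p w)) hz, e]
  ring

theorem coeff_slice_reflection (p : MvPolynomial (Fin 2) ℂ) {w : ℂ} (hw : ‖w‖ = 1) :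
    (slice (reflection p) w).coeff (p.degreeOf 0) =
      w ^ p.degreeOf 1 * (starRingEnd ℂ) (eval ![0, w] p) := by
  rw [slice_reflection p hw, Polynomial.coeff_C_mul, Polynomial.coeff_reflect,
    Polynomial.revAt_le le_rfl, Nat.sub_self, Polynomial.coeff_map, Polynomial.coeff_zero_eq_eval_zero,
    eval_slice]

theorem IsRIFDenominator.coeff_slice_reflection_ne_zero {p : MvPolynomial (Fin 2) ℂ}
    (hp : IsRIFDenominator p) {w : ℂ} (hw : ‖w‖ = 1) :
    (slice (reflection p) w).coeff (p.degreeOf 0) ≠ 0 := by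
  have hw0 : w ≠ 0 := by rintro rfl; simp at hw
  rw [coeff_slice_reflection p hw]
  exact mul_ne_zero (pow_ne_zero _ hw0) (by simpa using hp.eval_zero_ne_zero hw)

/-- If `z` is a zero of `p̃(·, w)` in `ℂ∖{0}`, then its reflection in the circle is a zero of
`p(·, w)`. -/
theorem eval_inv_conj_eq_zero {p : MvPolynomial (Fin 2) ℂ} {z w : ℂ} (hz : z ≠ 0) (hw : ‖w‖ = 1)
    (h : eval ![z, w] (reflection p) = 0) : eval ![((starRingEnd ℂ) z)⁻¹, w] p = 0 := by
  have hw0 : w ≠ 0 := by rintro rfl; simp at hw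
  rw [eval_reflection_of_norm_eq_one p hz hw] at h
  simpa [hz, hw0] using h

theorem IsRIFDenominator.norm_le_one_of_eval_reflection_eq_zero {p : MvPolynomial (Fin 2) ℂ}
    (hp : IsRIFDenominator p) {z w : ℂ} (hw : ‖w‖ = 1)
    (h : eval ![z, w] (reflection p) = 0) : ‖z‖ ≤ 1 := by
  by_contra! hz
  have hz0 : z ≠ 0 := by rintro rfl; simp at hz; linarith
  refine hp.eval_ne_zero_of_norm_eq_one ?_ hw (eval_inv_conj_eq_zero hz0 hw h)
  rw [norm_inv, RCLike.norm_conj]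
  exact inv_lt_one_of_one_lt₀ hz

theorem isTorusSingularity_of_eval_reflection_eq_zero {p : MvPolynomial (Fin 2) ℂ} {z w : ℂ}
    (hz : ‖z‖ = 1) (hw : ‖w‖ = 1) (h : eval ![z, w] (reflection p) = 0) :
    IsTorusSingularity p z w := by
  have hz0 : z ≠ 0 := by rintro rfl; simp at hz
  refine ⟨hz, hw, ?_, h⟩
  have h' := eval_inv_conj_eq_zero hz0 hw h
  rwa [← Complex.inv_eq_conj hz, inv_inv] at h'

/-! ### The double sum over the zeros -/

/-- The quantity `∑ j k, 1 / (1 - conj (a k) * a j)` attached to finitely many points of `𝔻`. It is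
comparable to `1 / (1 - max ‖a k‖)`, and, unlike the latter, it is a rational function
of `w ∈ 𝕋` when the `a k` are the zeros of `p̃(·, w)`. -/
noncomputable def szegoSum {m : ℕ} (a : Fin m → ℂ) : ℂ :=
  ∑ j, ∑ k, (1 - (starRingEnd ℂ) (a k) * a j)⁻¹

theorem norm_szegoSum_le {m : ℕ} {a : Fin m → ℂ} {e : ℝ} (he : 0 < e)
    (h : ∀ k, e ≤ 1 - ‖a k‖) : ‖szegoSum a‖ ≤ (m : ℝ) ^ 2 * e⁻¹ := by
  have key : ∀ j k, ‖(1 - (starRingEnd ℂ) (a k) * a j)⁻¹‖ ≤ e⁻¹ := by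
    intro j k
    rw [norm_inv]
    refine inv_anti₀ he ?_
    have h1 := norm_sub_norm_le (1 : ℂ) ((starRingEnd ℂ) (a k) * a j)
    rw [norm_mul, RCLike.norm_conj, norm_one] at h1
    nlinarith [h j, h k, norm_nonneg (a k), norm_nonneg (a j)]
  calc ‖szegoSum a‖ ≤ ∑ j : Fin m, ∑ k : Fin m, e⁻¹ :=
        norm_sum_le_of_le _ fun j _ => norm_sum_le_of_le _ fun k _ => key j k
    _ = _ := by simp; ring

theorem re_inv_one_sub_nonneg {b : ℂ} (hb : ‖b‖ ≤ 1) : 0 ≤ ((1 - b)⁻¹).re := by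
  rw [Complex.inv_re]
  refine div_nonneg ?_ (Complex.normSq_nonneg _)
  have := (Complex.re_le_norm b).trans hb
  simpa using this

theorem le_norm_szegoSum {m : ℕ} {a : Fin m → ℂ} (h : ∀ k, ‖a k‖ < 1) (j : Fin m) :
    (2 * (1 - ‖a j‖))⁻¹ ≤ ‖szegoSum a‖ := by
  refine le_trans ?_ (Complex.re_le_norm _)
  have hnn : ∀ i k, 0 ≤ ((1 - (starRingEnd ℂ) (a k) * a i)⁻¹).re := fun i k => by
    refine re_inv_one_sub_nonneg ?_
    rw [norm_mul, RCLike.norm_conj]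
    exact mul_le_one₀ (h k).le (norm_nonneg _) (h i).le
  have hdiag : (2 * (1 - ‖a j‖))⁻¹ ≤ ((1 - (starRingEnd ℂ) (a j) * a j)⁻¹).re := by
    have e : (1 - (starRingEnd ℂ) (a j) * a j)⁻¹ = (((1 - ‖a j‖ ^ 2)⁻¹ : ℝ) : ℂ) := by
      rw [Complex.conj_mul']; push_cast; rfl
    rw [e, Complex.ofReal_re]
    have := h j
    refine inv_anti₀ ?_ ?_ <;> nlinarith [norm_nonneg (a j)]
  rw [szegoSum, Complex.re_sum]
  refine hdiag.trans (le_trans ?_ (Finset.single_le_sum (f := fun i =>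
    (∑ k, (1 - (starRingEnd ℂ) (a k) * a i)⁻¹).re) (fun i _ => ?_) (Finset.mem_univ j)))
  · rw [Complex.re_sum]
    exact Finset.single_le_sum (f := fun k => ((1 - (starRingEnd ℂ) (a k) * a j)⁻¹).re)
      (fun k _ => hnn j k) (Finset.mem_univ j)
  · rw [Complex.re_sum]
    exact Finset.sum_nonneg fun k _ => hnn i k

/-- The logarithmic derivative of `∏ (1 - b k * X)`. -/
theorem eval_mul_sum_inv {m : ℕ} {b : Fin m → ℂ} {c : ℂ} {f : Polynomial ℂ}
    (hf : f = Polynomial.C c * ∏ k, (1 - Polynomial.C (b k) * Polynomial.X)) {z : ℂ}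
    (hz : f.eval z ≠ 0) :
    f.eval z * ∑ k, (1 - b k * z)⁻¹ = m * f.eval z - z * f.derivative.eval z := by
  have hev : f.eval z = c * ∏ k, (1 - b k * z) := by
    rw [hf]; simp [Polynomial.eval_prod]
  have hne : ∀ k, 1 - b k * z ≠ 0 := by
    rw [hev] at hz
    intro k
    exact Finset.prod_ne_zero_iff.mp (right_ne_zero_of_mul hz) k (Finset.mem_univ k)
  have hder : f.derivative.eval z = ∑ k, f.eval z * (1 - b k * z)⁻¹ * (-b k) := by
    rw [hev]
    conv_lhs => rw [hf, Polynomial.derivative_C_mul, Polynomial.derivative_prod_finset]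
    simp only [Polynomial.eval_mul, Polynomial.eval_C, Polynomial.eval_finsetSum,
      Polynomial.eval_prod, Finset.mul_sum]
    refine Finset.sum_congr rfl fun k _ => ?_
    rw [← Finset.mul_prod_erase Finset.univ _ (Finset.mem_univ k)]
    have h1 := mul_inv_cancel₀ (hne k)
    simp only [Polynomial.eval_one, Polynomial.eval_sub, Polynomial.eval_mul, Polynomial.eval_C,
      Polynomial.eval_X, Polynomial.derivative_sub, Polynomial.derivative_one,
      Polynomial.derivative_C_mul, Polynomial.derivative_X, mul_one, zero_sub, Polynomial.eval_neg]
    linear_combination (c * (∏ i ∈ Finset.univ.erase k, (1 - b i * z)) * b k) * h1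
  have hm : (m : ℂ) * f.eval z = ∑ k : Fin m, f.eval z := by simp
  rw [hder, Finset.mul_sum, Finset.mul_sum, hm, ← Finset.sum_sub_distrib]
  refine Finset.sum_congr rfl fun k _ => ?_
  field_simp [hne k]
  ring

/-- The slice of `p` in terms of the zeros `a k` of the slice of `p̃`. -/
theorem slice_eq_prod_of_roots {p : MvPolynomial (Fin 2) ℂ} {w : ℂ} (hw : ‖w‖ = 1)
    {a : Fin (p.degreeOf 0) → ℂ}
    (ha : Finset.univ.val.map a = (slice (reflection p) w).roots) :
    ∃ c, slice p w =
      Polynomial.C c * ∏ k, (1 - Polynomial.C ((starRingEnd ℂ) (a k)) * Polynomial.X) := by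
  have hw0 : w ≠ 0 := by rintro rfl; simp at hw
  set q := slice (reflection p) w with hq
  have hqe : ∀ z, q.eval z = q.leadingCoeff * ∏ k, (z - a k) := fun z => by
    conv_lhs => rw [(IsAlgClosed.splits q).eq_prod_roots, ← ha]
    rw [Polynomial.eval_mul, Polynomial.eval_C, Polynomial.eval_multiset_prod]
    simp only [Multiset.map_map]
    congr 1
    exact congrArg Multiset.prod (Multiset.map_congr rfl fun k _ => by simp)
  refine ⟨w ^ p.degreeOf 1 * (starRingEnd ℂ) q.leadingCoeff, ?_⟩
  refine Polynomial.eq_of_infinite_eval_eq _ _ <|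
    (Set.finite_singleton (0 : ℂ)).infinite_compl.mono fun z hz => ?_
  have hz : z ≠ 0 := hz
  have hcz : ((starRingEnd ℂ) z)⁻¹ ≠ 0 := inv_ne_zero (by simpa using hz)
  have h1 := eval_reflection_of_norm_eq_one p hcz hw
  rw [← eval_slice, ← hq, hqe, map_inv₀, Complex.conj_conj, inv_inv, ← eval_slice p] at h1
  have h2 := congrArg (starRingEnd ℂ) h1
  simp only [map_mul, map_pow, map_inv₀, Complex.conj_conj, map_prod, map_sub] at h2
  have h3 : ∏ k, (1 - (starRingEnd ℂ) (a k) * z) =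
      z ^ p.degreeOf 0 * ∏ k, (z⁻¹ - (starRingEnd ℂ) (a k)) := by
    have : z ^ p.degreeOf 0 = ∏ _k : Fin (p.degreeOf 0), z := by simp
    rw [this, ← Finset.prod_mul_distrib]
    refine Finset.prod_congr rfl fun k _ => ?_
    rw [mul_sub, mul_inv_cancel₀ hz, mul_comm]
  have h4 : w * (starRingEnd ℂ) w = 1 := by rw [Complex.mul_conj', hw]; simp
  show (slice p w).eval z = _
  simp only [Polynomial.eval_mul, Polynomial.eval_C, Polynomial.eval_prod, Polynomial.eval_sub,
    Polynomial.eval_one, Polynomial.eval_X, h3]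
  calc (slice p w).eval z = (w * (starRingEnd ℂ) w) ^ p.degreeOf 1 * (z * z⁻¹) ^ p.degreeOf 0 *
        (slice p w).eval z := by rw [h4, mul_inv_cancel₀ hz]; simp
    _ = w ^ p.degreeOf 1 * z ^ p.degreeOf 0 * (z⁻¹ ^ p.degreeOf 0 *
        (starRingEnd ℂ) w ^ p.degreeOf 1 * (slice p w).eval z) := by ring
    _ = _ := by rw [← h2]; ring

/-! ### Symmetric functions of the roots depend analytically on the parameter -/

section Roots

variable {m : ℕ} {Q : Polynomial (Polynomial ℂ)} {τ : ℂ} {ρ : ℂ → Fin m → ℂ}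

theorem analyticAt_eval_polynomial (f : Polynomial ℂ) (τ : ℂ) :
    AnalyticAt ℂ (fun w => f.eval w) τ := by
  simpa using AnalyticAt.aeval_polynomial (analyticAt_id (𝕜 := ℂ) (z := τ)) f

theorem card_eq_of_map_eq_roots {f : Polynomial ℂ} {a : Fin m → ℂ}
    (ha : Finset.univ.val.map a = f.roots) : f.natDegree = m := by
  rw [(IsAlgClosed.splits f).natDegree_eq_card_roots, ← ha]
  simp

theorem exists_map_eq_roots {f : Polynomial ℂ} (hm : f.natDegree ≤ m) (h : f.coeff m ≠ 0) :
    ∃ a : Fin m → ℂ, Finset.univ.val.map a = f.roots := by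
  have hd : f.roots.card = m := by
    rw [← (IsAlgClosed.splits f).natDegree_eq_card_roots]
    exact le_antisymm hm (Polynomial.le_natDegree_of_ne_zero h)
  obtain ⟨l, hl⟩ := Quot.exists_rep f.roots
  have hl' : (l : Multiset ℂ) = f.roots := hl
  have hlen : l.length = m := by rw [← hd, ← hl', Multiset.coe_card]
  subst hlen
  refine ⟨l.get, ?_⟩
  rw [← hl', Fin.univ_val_map, List.ofFn_get]

theorem analyticAt_esymm (hτ : (Q.coeff m).eval τ ≠ 0)
    (hρ : ∀ᶠ w in nhds τ,
      Finset.univ.val.map (ρ w) = (Q.map (Polynomial.evalRingHom w)).roots) (k : ℕ) :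
    AnalyticAt ℂ (fun w => (Finset.univ.val.map (ρ w)).esymm k) τ := by
  by_cases hk : k ≤ m
  · have han : AnalyticAt ℂ (fun w => (-1) ^ k * (Q.coeff (m - k)).eval w / (Q.coeff m).eval w) τ :=
      (analyticAt_const.mul (analyticAt_eval_polynomial _ τ)).div
        (analyticAt_eval_polynomial _ τ) hτ
    refine han.congr ?_
    have hL := (analyticAt_eval_polynomial (Q.coeff m) τ).continuousAt.eventually_ne hτ
    filter_upwards [hρ, hL] with w hw hLw
    have hd := card_eq_of_map_eq_roots hw
    have hv := Polynomial.coeff_eq_esymm_roots_of_card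
      (p := Q.map (Polynomial.evalRingHom w)) (k := m - k)
      (IsAlgClosed.splits _).natDegree_eq_card_roots.symm (by rw [hd]; exact Nat.sub_le _ _)
    rw [hd, Nat.sub_sub_self hk, Polynomial.leadingCoeff, hd, Polynomial.coeff_map,
      Polynomial.coeff_map, ← hw] at hv
    simp only [Polynomial.coe_evalRingHom] at hv
    rw [hv, div_eq_iff hLw]
    have h1 : ((-1 : ℂ) ^ k) * (-1) ^ k = 1 := by rw [← mul_pow]; simp
    linear_combination (Q.coeff m).eval w * (Finset.univ.val.map (ρ w)).esymm k * h1
  · have : (fun w => (Finset.univ.val.map (ρ w)).esymm k) = fun _ => 0 := by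
      funext w
      rw [Multiset.esymm, Multiset.powersetCard_eq_empty _ (by simpa using hk)]
      simp
    rw [this]
    exact analyticAt_const

theorem analyticAt_psum (hτ : (Q.coeff m).eval τ ≠ 0)
    (hρ : ∀ᶠ w in nhds τ,
      Finset.univ.val.map (ρ w) = (Q.map (Polynomial.evalRingHom w)).roots) (k : ℕ) :
    AnalyticAt ℂ (fun w => ∑ j, ρ w j ^ k) τ := by
  induction k using Nat.strong_induction_on with
  | _ k ih =>
    rcases Nat.eq_zero_or_pos k with rfl | hk
    · simpa using analyticAt_const
    have he := analyticAt_esymm hτ hρ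
    have hfun : (fun w => ∑ j, ρ w j ^ k) = fun w =>
        (-1) ^ (k + 1) * k * (Finset.univ.val.map (ρ w)).esymm k -
        ∑ a ∈ Finset.HasAntidiagonal.antidiagonal k with a.1 ∈ Set.Ioo 0 k,
          (-1) ^ a.1 * (Finset.univ.val.map (ρ w)).esymm a.1 * ∑ j, ρ w j ^ a.2 := by
      funext w
      have := congrArg (aeval (ρ w)) (psum_eq_mul_esymm_sub_sum (Fin m) ℂ k hk)
      simp only [← aeval_esymm_eq_multiset_esymm (Fin m) ℂ]
      simpa [psum] using this
    rw [hfun]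
    refine (analyticAt_const.mul (he k)).sub (Finset.analyticAt_fun_sum _ fun a ha => ?_)
    refine (analyticAt_const.mul (he a.1)).mul (ih a.2 ?_)
    simp only [Finset.mem_filter, Finset.HasAntidiagonal.mem_antidiagonal, Set.mem_Ioo] at ha
    omega

theorem analyticAt_sum_evalEval_roots (hτ : (Q.coeff m).eval τ ≠ 0)
    (hρ : ∀ᶠ w in nhds τ,
      Finset.univ.val.map (ρ w) = (Q.map (Polynomial.evalRingHom w)).roots)
    (H : Polynomial (Polynomial ℂ)) :
    AnalyticAt ℂ (fun w => ∑ j, H.evalEval w (ρ w j)) τ := by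
  have hfun : (fun w => ∑ j, H.evalEval w (ρ w j)) =
      fun w => ∑ i ∈ H.support, (H.coeff i).eval w * ∑ j, ρ w j ^ i := by
    funext w
    simp only [Finset.mul_sum]
    rw [Finset.sum_comm]
    refine Finset.sum_congr rfl fun j _ => ?_
    rw [← Polynomial.map_evalRingHom_eval, Polynomial.eval_map, Polynomial.eval₂_eq_sum,
      Polynomial.sum_def]
    rfl
  rw [hfun]
  exact Finset.analyticAt_fun_sum _ fun i _ =>
    (analyticAt_eval_polynomial _ τ).mul (analyticAt_psum hτ hρ i)

end Roots

/-! ### Local estimates at a point of the circle -/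

open Filter Topology in
/-- The point `τ` is not isolated on the unit circle. -/
theorem neBot_nhdsWithin_circle {τ : ℂ} (hτ : ‖τ‖ = 1) :
    (𝓝[{w : ℂ | ‖w‖ = 1} ∩ {τ}ᶜ] τ).NeBot := by
  have hτ0 : τ ≠ 0 := by rintro rfl; simp at hτ
  set γ : ℝ → ℂ := fun t => τ * Complex.exp (t * Complex.I) with hγ
  have hγ0 : γ 0 = τ := by simp [hγ]
  have hd : HasDerivAt γ (τ * Complex.I) 0 := by
    have h1 : HasDerivAt (fun t : ℝ => (t : ℂ) * Complex.I) Complex.I 0 := by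
      simpa using (Complex.ofRealCLM.hasDerivAt (x := 0)).mul_const Complex.I
    simpa using h1.cexp.const_mul τ
  have hne : ∀ᶠ t in 𝓝[≠] (0 : ℝ), γ t ≠ τ := by
    have := hd.eventually_ne (c := τ) (mul_ne_zero hτ0 Complex.I_ne_zero)
    simpa using this
  have ht : Tendsto γ (𝓝[≠] 0) (𝓝[{w : ℂ | ‖w‖ = 1} ∩ {τ}ᶜ] τ) := by
    refine tendsto_nhdsWithin_iff.mpr ⟨?_, ?_⟩
    · have := hd.continuousAt.tendsto
      rw [hγ0] at this
      exact this.mono_left nhdsWithin_le_nhds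
    · filter_upwards [hne] with t h
      exact ⟨by simp [hγ, hτ, Complex.norm_exp_ofReal_mul_I], h⟩
  exact ht.neBot

open Filter Topology in
/-- A nonzero germ is comparable to a power of the distance, the exponent being its order. -/
theorem exists_norm_bounds_of_analyticAt {f : ℂ → ℂ} {τ : ℂ} (hf : AnalyticAt ℂ f τ)
    (h0 : ¬ ∀ᶠ w in 𝓝 τ, f w = 0) : ∃ n : ℕ, ∃ c C : ℝ, 0 < c ∧ 0 < C ∧
      ∀ᶠ w in 𝓝 τ, c * ‖τ - w‖ ^ n ≤ ‖f w‖ ∧ ‖f w‖ ≤ C * ‖τ - w‖ ^ n := by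
  obtain ⟨n, g, hg, hg0, hfg⟩ := hf.exists_eventuallyEq_pow_smul_nonzero_iff.mpr h0
  have hpos : 0 < ‖g τ‖ := norm_pos_iff.mpr hg0
  have hcont := hg.continuousAt.norm
  refine ⟨n, ‖g τ‖ / 2, 2 * ‖g τ‖, by positivity, by positivity, ?_⟩
  filter_upwards [hfg, hcont.eventually_const_le (u := ‖g τ‖ / 2) (by linarith),
    hcont.eventually_le_const (u := 2 * ‖g τ‖) (by linarith)] with w hw h1 h2
  rw [hw, norm_smul, norm_pow, norm_sub_rev w τ, mul_comm (‖τ - w‖ ^ n)]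
  constructor <;> gcongr

open Filter Topology in
theorem HasContactExponent.unique {p : MvPolynomial (Fin 2) ℂ} {τ : ℂ} (hτ : ‖τ‖ = 1) {K K' : ℝ}
    (h : HasContactExponent p τ K) (h' : HasContactExponent p τ K') : K = K' := by
  have key : ∀ {K K' : ℝ}, HasContactExponent p τ K → HasContactExponent p τ K' → ¬ K < K' := by
    rintro K K' ⟨c, _, hc, _, U, hU, h⟩ ⟨_, C, _, _, V, hV, h'⟩ hlt
    have := neBot_nhdsWithin_circle hτ
    have ht : Tendsto (fun w => C * ‖τ - w‖ ^ (K' - K)) (𝓝[{w : ℂ | ‖w‖ = 1} ∩ {τ}ᶜ] τ) (𝓝 0) := by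
      have hcont : ContinuousAt (fun w => C * ‖τ - w‖ ^ (K' - K)) τ := by
        refine continuousAt_const.mul (ContinuousAt.rpow_const (by fun_prop) (Or.inr ?_))
        linarith
      have := hcont.tendsto
      rw [sub_self, norm_zero, Real.zero_rpow (by linarith), mul_zero] at this
      exact this.mono_left nhdsWithin_le_nhds
    refine absurd (ge_of_tendsto ht (b := c) ?_) (not_le.mpr hc)
    filter_upwards [mem_nhdsWithin_of_mem_nhds hU, mem_nhdsWithin_of_mem_nhds hV,
      self_mem_nhdsWithin] with w hwU hwV hw
    have hpos : 0 < ‖τ - w‖ := norm_pos_iff.mpr (sub_ne_zero.mpr fun e => hw.2 e.symm)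
    have h1 := (h w hwU hw.1).1.trans (h' w hwV hw.1).2
    rw [Real.rpow_sub hpos, ← mul_div_assoc, le_div_iff₀ (by positivity)]
    exact h1
  exact le_antisymm (not_lt.mp (key h' h)) (not_lt.mp (key h h'))

/-! ### The distance of the zeros to the circle -/

section ZeroDistance

variable {p : MvPolynomial (Fin 2) ℂ} {w : ℂ} {a : Fin (p.degreeOf 0) → ℂ}

/-- Factorization of `p̃(·, w)` over its zeros; the hypothesis on `a` forces the slice to have full
degree in `z₁`. -/
theorem eval_reflection_eq_prod (ha : Finset.univ.val.map a = (slice (reflection p) w).roots)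
    (z : ℂ) : eval ![z, w] (reflection p) =
      (slice (reflection p) w).coeff (p.degreeOf 0) * ∏ k, (z - a k) := by
  have hd := card_eq_of_map_eq_roots ha
  rw [← eval_slice]
  conv_lhs => rw [(IsAlgClosed.splits (slice (reflection p) w)).eq_prod_roots, ← ha]
  rw [Polynomial.eval_mul, Polynomial.eval_C, Polynomial.eval_multiset_prod,
    Polynomial.leadingCoeff, hd]
  simp only [Multiset.map_map]
  congr 1
  exact congrArg Multiset.prod (Multiset.map_congr rfl fun k _ => by simp)

theorem eval_reflection_eq_zero_iff (hL : (slice (reflection p) w).coeff (p.degreeOf 0) ≠ 0)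
    (ha : Finset.univ.val.map a = (slice (reflection p) w).roots) (z : ℂ) :
    eval ![z, w] (reflection p) = 0 ↔ ∃ k, z = a k := by
  rw [eval_reflection_eq_prod ha, mul_eq_zero, or_iff_right hL, Finset.prod_eq_zero_iff]
  simp [sub_eq_zero]

/-- If all zeros of the slice of `p̃` lie in `𝔻`, there is no singularity over `w` and the infimum in
`zeroDistance` is attained. -/
theorem zeroDistance_eq_min (hm : p.degreeOf 0 ≠ 0)
    (hL : (slice (reflection p) w).coeff (p.degreeOf 0) ≠ 0)
    (ha : Finset.univ.val.map a = (slice (reflection p) w).roots) (hlt : ∀ k, ‖a k‖ < 1) :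
    (∀ k, zeroDistance p w ≤ 1 - ‖a k‖) ∧ ∃ j, zeroDistance p w = 1 - ‖a j‖ := by
  have hns : ¬ ∃ τ₁ : ℂ, IsTorusSingularity p τ₁ w := by
    rintro ⟨t, ht, -, -, h⟩
    obtain ⟨k, rfl⟩ := (eval_reflection_eq_zero_iff hL ha t).mp h
    exact (hlt k).ne ht
  have : Nonempty (Fin (p.degreeOf 0)) := ⟨⟨0, Nat.pos_of_ne_zero hm⟩⟩
  obtain ⟨j, hj⟩ := Finite.exists_min fun k => 1 - ‖a k‖
  have hleast : IsLeast {t : ℝ | ∃ z₁ : ℂ, eval ![z₁, w] (reflection p) = 0 ∧ t = 1 - ‖z₁‖}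
      (1 - ‖a j‖) := by
    refine ⟨⟨a j, (eval_reflection_eq_zero_iff hL ha _).mpr ⟨j, rfl⟩, rfl⟩, ?_⟩
    rintro t ⟨z, hz, rfl⟩
    obtain ⟨k, rfl⟩ := (eval_reflection_eq_zero_iff hL ha z).mp hz
    exact hj k
  have he : zeroDistance p w = 1 - ‖a j‖ := by
    rw [zeroDistance, if_neg hns, hleast.csInf_eq]
  exact ⟨fun k => he ▸ hj k, j, he⟩

open Polynomial in
/-- The Bézout relation `u * p + v * p̃ = r(z₂)` turns `r(w)` times the double sum over the zeros of
`p̃(·, w)` into a sum of the values of one polynomial at these zeros. -/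
theorem sum_evalEval_eq_mul_szegoSum {u v : ℂ[X][X]} {r : ℂ[X]}
    (hr : u * toBivariate p + v * toBivariate (reflection p) = Polynomial.C r) (hw : ‖w‖ = 1)
    (hrw : r.eval w ≠ 0) (hL : (slice (reflection p) w).coeff (p.degreeOf 0) ≠ 0)
    (ha : Finset.univ.val.map a = (slice (reflection p) w).roots) :
    ∑ j, ((((p.degreeOf 0 : ℂ[X][X]) * toBivariate p - Polynomial.X *
      derivative (toBivariate p)) * u).evalEval w (a j)) = r.eval w * szegoSum a := by
  obtain ⟨c, hc⟩ := slice_eq_prod_of_roots hw ha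
  rw [szegoSum, Finset.mul_sum]
  refine Finset.sum_congr rfl fun j _ => ?_
  have hq := (eval_reflection_eq_zero_iff hL ha (a j)).mpr ⟨j, rfl⟩
  have hup : u.evalEval w (a j) * (slice p w).eval (a j) = r.eval w := by
    have := congrArg (fun f => f.evalEval w (a j)) hr
    simpa [evalEval_toBivariate, hq, eval_slice, Polynomial.evalEval_C] using this
  have hne : (slice p w).eval (a j) ≠ 0 := fun h => hrw (by rw [← hup, h, mul_zero])
  have hlog := eval_mul_sum_inv hc hne
  have hder : (slice p w).derivative.eval (a j) =
      (derivative (toBivariate p)).evalEval w (a j) := by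
    rw [slice, Polynomial.derivative_map, Polynomial.map_evalRingHom_eval]
  rw [← hup, mul_assoc, hlog, hder, eval_slice, ← evalEval_toBivariate]
  simp only [Polynomial.evalEval_mul, Polynomial.evalEval_sub, Polynomial.evalEval_natCast,
    Polynomial.evalEval_X]
  ring

/-- A denominator independent of `z₁` has no singularity: it would vanish on a whole line. -/
theorem IsRIFDenominator.degreeOf_ne_zero (hp : IsRIFDenominator p) {τ₁ τ₂ : ℂ}
    (h : IsTorusSingularity p τ₁ τ₂) : p.degreeOf 0 ≠ 0 := by
  intro hm
  have hd := natDegree_slice_le p τ₂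
  rw [hm, Nat.le_zero] at hd
  have e := Polynomial.eq_C_of_natDegree_eq_zero hd
  refine hp.eval_zero_ne_zero h.2.1 ?_
  have h' := h.2.2.1
  rw [← eval_slice, e] at h' ⊢
  simpa using h'

open Polynomial in
theorem IsRIFDenominator.exists_bezout (hp : IsRIFDenominator p) :
    ∃ u v : ℂ[X][X], ∃ r : ℂ[X], r ≠ 0 ∧
      u * toBivariate p + v * toBivariate (reflection p) = Polynomial.C r := by
  refine exists_mul_add_mul_eq_C_of_isRelPrime fun d h1 h2 => ?_
  have h := hp.isRelPrime (d := toBivariate.symm d) ((map_dvd_iff toBivariate).mp (by simpa using h1))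
    ((map_dvd_iff toBivariate).mp (by simpa using h2))
  simpa using h.map toBivariate

open Polynomial in
theorem IsRIFDenominator.norm_lt_one_of_bezout (hp : IsRIFDenominator p) {u v : ℂ[X][X]} {r : ℂ[X]}
    (hr : u * toBivariate p + v * toBivariate (reflection p) = Polynomial.C r) (hw : ‖w‖ = 1)
    (hrw : r.eval w ≠ 0) {z : ℂ} (hz : MvPolynomial.eval ![z, w] (reflection p) = 0) : ‖z‖ < 1 := by
  refine lt_of_le_of_ne (hp.norm_le_one_of_eval_reflection_eq_zero hw hz) fun h1 => hrw ?_
  have hs := isTorusSingularity_of_eval_reflection_eq_zero h1 hw hz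
  have := congrArg (fun f => f.evalEval w z) hr
  simpa [evalEval_toBivariate, hz, hs.2.2.1, Polynomial.evalEval_C] using this.symm

end ZeroDistance

/-! ### Existence and uniqueness of the exponent -/

open Filter Topology in
theorem theorem3p3 (p : MvPolynomial (Fin 2) ℂ) (hp : IsRIFDenominator p)
    (τ₂ : ℂ) (hτ₂ : ∃ τ₁ : ℂ, IsTorusSingularity p τ₁ τ₂) :
    ∃! K : ℚ, 0 < K ∧ HasContactExponent p τ₂ (K : ℝ) := by
  obtain ⟨τ₁, hs⟩ := hτ₂
  have hm := hp.degreeOf_ne_zero hs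
  have hτ := hs.2.1
  have hT := neBot_nhdsWithin_circle hτ
  obtain ⟨u, v, r, hr0, hr⟩ := hp.exists_bezout
  have hcoeff : ∀ w, (slice (reflection p) w).coeff (p.degreeOf 0) =
      ((toBivariate (reflection p)).coeff (p.degreeOf 0)).eval w := fun w => by
    simp [slice]
  have hex : ∀ w, ∃ a : Fin (p.degreeOf 0) → ℂ,
      (slice (reflection p) w).coeff (p.degreeOf 0) ≠ 0 →
      Finset.univ.val.map a = (slice (reflection p) w).roots := fun w => by
    by_cases h : (slice (reflection p) w).coeff (p.degreeOf 0) = 0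
    · exact ⟨0, fun h' => absurd h h'⟩
    · obtain ⟨a, ha⟩ := exists_map_eq_roots (natDegree_slice_reflection_le p w) h
      exact ⟨a, fun _ => ha⟩
  -- `ρ w` enumerates the zeros of `p̃(·, w)` for all complex `w` near `τ₂`, on and off the circle
  choose ρ hρ using hex
  have hLτ : ((toBivariate (reflection p)).coeff (p.degreeOf 0)).eval τ₂ ≠ 0 := by
    rw [← hcoeff]; exact hp.coeff_slice_reflection_ne_zero hτ
  have hLev : ∀ᶠ w in 𝓝 τ₂, ((toBivariate (reflection p)).coeff (p.degreeOf 0)).eval w ≠ 0 :=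
    (analyticAt_eval_polynomial _ τ₂).continuousAt.eventually_ne hLτ
  set H := ((p.degreeOf 0 : Polynomial (Polynomial ℂ)) * toBivariate p - Polynomial.X *
    Polynomial.derivative (toBivariate p)) * u with hH
  have hNan : AnalyticAt ℂ (fun w => ∑ j, H.evalEval w (ρ w j)) τ₂ := by
    refine analyticAt_sum_evalEval_roots hLτ ?_ H
    filter_upwards [hLev] with w hw
    exact hρ w (by rwa [hcoeff])
  -- On the circle, the analytic function `N w = ∑ j, H(ρ w j, w)` is `r w` times the double sum, so
  -- `ε` is comparable to `‖r‖ / ‖N‖`. The last bound, from `‖τ₁ - ρ w k‖ ≥ ε`, serves to show `ε → 0`.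
  have hcomp : ∀ w, ‖w‖ = 1 → r.eval w ≠ 0 → 0 < zeroDistance p w ∧
      (2 * zeroDistance p w)⁻¹ * ‖r.eval w‖ ≤ ‖∑ j, H.evalEval w (ρ w j)‖ ∧
      ‖∑ j, H.evalEval w (ρ w j)‖ ≤
        (p.degreeOf 0 : ℝ) ^ 2 * (zeroDistance p w)⁻¹ * ‖r.eval w‖ ∧
      ‖(slice (reflection p) w).coeff (p.degreeOf 0)‖ * zeroDistance p w ^ p.degreeOf 0 ≤
        ‖eval ![τ₁, w] (reflection p)‖ := by
    intro w hw hrw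
    have hL := hp.coeff_slice_reflection_ne_zero hw
    have ha := hρ w hL
    have hlt : ∀ k, ‖ρ w k‖ < 1 := fun k =>
      hp.norm_lt_one_of_bezout hr hw hrw ((eval_reflection_eq_zero_iff hL ha _).mpr ⟨k, rfl⟩)
    obtain ⟨hmin, j, hj⟩ := zeroDistance_eq_min hm hL ha hlt
    have hpos : 0 < zeroDistance p w := by rw [hj]; linarith [hlt j]
    rw [hH, sum_evalEval_eq_mul_szegoSum hr hw hrw hL ha, norm_mul, mul_comm ‖r.eval w‖]
    refine ⟨hpos, ?_, ?_, ?_⟩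
    · rw [hj]
      gcongr
      exact le_norm_szegoSum hlt j
    · gcongr
      exact norm_szegoSum_le hpos hmin
    · rw [eval_reflection_eq_prod ha, norm_mul, norm_prod]
      gcongr
      calc zeroDistance p w ^ p.degreeOf 0 = ∏ _k : Fin (p.degreeOf 0), zeroDistance p w := by simp
        _ ≤ _ := Finset.prod_le_prod (fun _ _ => hpos.le) fun k _ => by
          have := norm_sub_norm_le τ₁ (ρ w k)
          rw [hs.1] at this
          exact (hmin k).trans this
  have hran := analyticAt_eval_polynomial r τ₂
  have hr0' : ¬ ∀ᶠ w in 𝓝 τ₂, r.eval w = 0 := fun h =>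
    hr0 (Polynomial.eq_zero_of_infinite_isRoot r (infinite_of_mem_nhds τ₂ h))
  have hrne : ∀ᶠ w in 𝓝[≠] τ₂, r.eval w ≠ 0 :=
    hran.eventually_eq_zero_or_eventually_ne_zero.resolve_left hr0'
  have hrne' : ∀ᶠ w in 𝓝 τ₂, w ≠ τ₂ → r.eval w ≠ 0 := eventually_nhdsWithin_iff.mp hrne
  have hN0 : ¬ ∀ᶠ w in 𝓝 τ₂, ∑ j, H.evalEval w (ρ w j) = 0 := by
    intro h
    have : ∀ᶠ w in 𝓝[{w : ℂ | ‖w‖ = 1} ∩ {τ₂}ᶜ] τ₂, False := by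
      filter_upwards [h.filter_mono nhdsWithin_le_nhds, hrne'.filter_mono nhdsWithin_le_nhds,
        self_mem_nhdsWithin] with w h1 h2 hw
      have h3 := h2 hw.2
      obtain ⟨hpos, h4, -⟩ := hcomp w hw.1 h3
      rw [h1, norm_zero] at h4
      have : 0 < ‖r.eval w‖ := norm_pos_iff.mpr h3
      exact absurd h4 (not_le.mpr (by positivity))
    exact (this.exists).elim fun _ h => h
  obtain ⟨b, c₁, C₁, hc₁, hC₁, hrb⟩ := exists_norm_bounds_of_analyticAt hran hr0'
  obtain ⟨n, c₂, C₂, hc₂, hC₂, hNb⟩ := exists_norm_bounds_of_analyticAt hNan hN0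
  have hm' : (0 : ℝ) < p.degreeOf 0 := by exact_mod_cast Nat.pos_of_ne_zero hm
  have hbounds : ∀ᶠ w in 𝓝 τ₂, ‖w‖ = 1 → w ≠ τ₂ →
      c₁ / (2 * C₂) * ‖τ₂ - w‖ ^ ((b : ℝ) - n) ≤ zeroDistance p w ∧
      zeroDistance p w ≤ (p.degreeOf 0 : ℝ) ^ 2 * C₁ / c₂ * ‖τ₂ - w‖ ^ ((b : ℝ) - n) := by
    filter_upwards [hrb, hNb, hrne'] with w h1 h2 h3 hw hwτ
    obtain ⟨hpos, h4, h5, -⟩ := hcomp w hw (h3 hwτ)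
    have hd : 0 < ‖τ₂ - w‖ := norm_pos_iff.mpr (sub_ne_zero.mpr hwτ.symm)
    rw [Real.rpow_sub hd, Real.rpow_natCast, Real.rpow_natCast]
    rw [inv_mul_le_iff₀ (by positivity)] at h4
    rw [mul_right_comm, ← div_eq_mul_inv, le_div_iff₀ hpos] at h5
    have hdn : 0 < ‖τ₂ - w‖ ^ n := by positivity
    constructor
    · rw [div_mul_div_comm, div_le_iff₀ (by positivity)]
      calc _ ≤ _ := h1.1
        _ ≤ _ := h4
        _ ≤ 2 * zeroDistance p w * (C₂ * ‖τ₂ - w‖ ^ n) := by gcongr; exact h2.2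
        _ = _ := by ring
    · rw [div_mul_div_comm, le_div_iff₀ (by positivity)]
      calc _ = c₂ * ‖τ₂ - w‖ ^ n * zeroDistance p w := by ring
        _ ≤ _ := mul_le_mul_of_nonneg_right h2.1 hpos.le
        _ ≤ _ := h5
        _ ≤ (p.degreeOf 0 : ℝ) ^ 2 * (C₁ * ‖τ₂ - w‖ ^ b) := by gcongr; exact h1.2
        _ = _ := by ring
  -- Otherwise `ε` would stay away from `0` near `τ₂`, although `p̃(τ₁, w) → 0`.
  have hK : n < b := by
    by_contra! hbn
    have hexp : (b : ℝ) - n ≤ 0 := by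
      have : (b : ℝ) ≤ n := by exact_mod_cast hbn
      linarith
    have hlim : Tendsto (fun w => ‖eval ![τ₁, w] (reflection p)‖)
        (𝓝[{w : ℂ | ‖w‖ = 1} ∩ {τ₂}ᶜ] τ₂) (𝓝 0) := by
      have := (continuous_eval_pair (reflection p) τ₁).norm.tendsto τ₂
      rw [hs.2.2.2, norm_zero] at this
      exact this.mono_left nhdsWithin_le_nhds
    have hlim' : Tendsto (fun w => ‖((toBivariate (reflection p)).coeff (p.degreeOf 0)).eval w‖ *
        (c₁ / (2 * C₂)) ^ p.degreeOf 0) (𝓝[{w : ℂ | ‖w‖ = 1} ∩ {τ₂}ᶜ] τ₂)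
        (𝓝 (‖((toBivariate (reflection p)).coeff (p.degreeOf 0)).eval τ₂‖ *
        (c₁ / (2 * C₂)) ^ p.degreeOf 0)) :=
      (((analyticAt_eval_polynomial _ τ₂).continuousAt.norm.tendsto).mono_left
        nhdsWithin_le_nhds).mul_const _
    have hball : ∀ᶠ w in 𝓝 τ₂, ‖τ₂ - w‖ ≤ 1 := by
      filter_upwards [Metric.closedBall_mem_nhds τ₂ one_pos] with w hw
      rwa [mem_closedBall_iff_norm, norm_sub_rev] at hw
    have hle := le_of_tendsto_of_tendsto hlim' hlim (by
      filter_upwards [hbounds.filter_mono nhdsWithin_le_nhds,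
        hrne'.filter_mono nhdsWithin_le_nhds, hball.filter_mono nhdsWithin_le_nhds,
        self_mem_nhdsWithin] with w h1 h2 h3 hw
      have h4 := (h1 hw.1 hw.2).1
      have hd : 0 < ‖τ₂ - w‖ := norm_pos_iff.mpr (sub_ne_zero.mpr fun e => hw.2 e.symm)
      have h5 := Real.one_le_rpow_of_pos_of_le_one_of_nonpos hd h3 hexp
      have h6 : c₁ / (2 * C₂) ≤ zeroDistance p w :=
        (le_mul_of_one_le_right (by positivity) h5).trans h4
      refine le_trans ?_ (hcomp w hw.1 (h2 hw.2)).2.2.2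
      rw [hcoeff]
      gcongr)
    have : 0 < ‖((toBivariate (reflection p)).coeff (p.degreeOf 0)).eval τ₂‖ := norm_pos_iff.mpr hLτ
    exact absurd hle (not_le.mpr (by positivity))
  have hKpos : (0 : ℝ) < (b : ℝ) - n := by
    have : (n : ℝ) < b := by exact_mod_cast hK
    linarith
  have hcontact : HasContactExponent p τ₂ ((b : ℝ) - n) := by
    refine ⟨c₁ / (2 * C₂), (p.degreeOf 0 : ℝ) ^ 2 * C₁ / c₂, by positivity, by positivity, _,
      hbounds, fun w hw hw1 => ?_⟩
    rcases eq_or_ne w τ₂ with rfl | hne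
    · rw [zeroDistance, if_pos ⟨τ₁, hs⟩, sub_self, norm_zero, Real.zero_rpow hKpos.ne']
      simp
    · exact hw hw1 hne
  refine ⟨(b : ℚ) - n, ⟨by exact_mod_cast hKpos, by push_cast; exact hcontact⟩, ?_⟩
  rintro K' ⟨-, hK'⟩
  have := hK'.unique hτ hcontact
  exact_mod_cast this
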